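/- **Notation.** Let $d\ge 1$ and write $\langle z,w\rangle=\sum_i z_i\overline{w_i}$ for $z,w\in\mathbb C^d$. For $p,q\ge0$ let $H(p,q)$ be the complex vector space of harmonic polynomials on $\mathbb C^d\cong\mathbb R^{2d}$ that are homogeneous of degree $p$ in $z_1,\dots,z_d$ and homogeneous of degree $q$ in $\overline{z_1},\dots,\overline{z_d}$. Let $$Q_{pq}(z)=Q_{pq}^{(d)}(z)=\frac{p+q+d-1}{(d-1)!}\sum_{j=0}^{\min\{p,q\}}(-1)^j\frac{(d+p+q-j-2)!}{j!\,(p-j)!\,(q-j)!}\,z^{p-j}\,\overline z^{\,q-j},\qquad z\in\mathbb C,$$ where $Q_{00}=1$ (also for $d=1$). For a finite set $\tau\subset\mathbb N^2$, a sequence of unit vectors $(v_1,\dots,v_n)$ in $\mathbb C^d$ is a *spherical $\tau$-design* if $\int_{\mathbb S}g\,d\sigma=\frac1n\sum_{j=1}^n g(v_j)$ for all $g\in P_\tau=\bigoplus_{(p,q)\in\tau}H(p,q)$, where $\sigma$ is the normalised surface measure on the unit sphere $\mathbb S$ of $\mathbb C^d$. **Theorem.** Let $X=(v_j)$ be a sequence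 of $n$ unit vectors in $\mathbb C^d$, $d\ge1$, and let $F=\sum_{(p,q)}f_{pq}Q_{pq}$ be a finite sum with $f_{pq}\in\mathbb C$ and $F(1)=1$. Put $$A:=\{z\in\mathbb C:|z|\le1,\ F(z)=0\},\qquad \tau:=\{(p,q):f_{pq}\ne0\}.$$ Then the $n\times n$ matrix $M=[F(\langle v_j,v_k\rangle)]_{j,k=1}^n$ satisfies $$\operatorname{rank}(M)\le\min\Bigl\{n,\ \sum_{(p,q)\in\tau}\dim H(p,q)\Bigr\}.$$ In particular, if $X$ is an $A$-code, i.e. $\langle v_j,v_k\rangle\in A$ for all $j\ne k$, then $$n\le\sum_{(p,q)\in\tau}\dim H(p,q),$$ with equality if and only if $$F=\frac1n\sum_{(p,q)\in\tau}Q_{pq}$$ on the set of all inner products $\langle z,w\rangle$ of unit vectors $z,w\in\mathbb C^d$ (the closed unit disc if $d\ge2$, the unit circle if $d=1$). If $d\ge2$, or if $H(p,q)\ne0$ for all $(p,q)\in\tau$, then equality holds if and only if this identity holds on all of $\mathbb C$, i.e. as an identity of polynomials in $z,\overline z$. When equality holds, the angles $\langle v_j,v_k\rangle$, $j\neq k$,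 of $X$ are roots of $F$, and $X$ is a spherical $\tau$-design if and only if $(0,0)\in\tau$. -/

import Mathlib

open scoped Nat ComplexConjugate

noncomputable section

namespace ComplexDesign

/-- The vector space `ℂ^d` with its Euclidean norm. -/
abbrev Cd (d : ℕ) : Type := EuclideanSpace ℂ (Fin d)

/-- The inner product `⟨z, w⟩ = ∑ i, z_i * conj w_i`, linear in the first argument. -/
def ip {d : ℕ} (z w : Cd d) : ℂ := inner ℂ w z

theorem ip_eq_sum {d : ℕ} (z w : Cd d) : ip z w = ∑ i, z i * conj (w i) := by
  simp [ip, PiLp.inner_apply]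

/-- Polynomials in the `2d` variables `z_1, …, z_d` (the `Sum.inl i`) and
`conj z_1, …, conj z_d` (the `Sum.inr i`). -/
abbrev Poly (d : ℕ) : Type := MvPolynomial (Fin d ⊕ Fin d) ℂ

/-- The polynomial function on `ℂ^d` given by an element of `Poly d`. -/
def evalAt {d : ℕ} (P : Poly d) (z : Cd d) : ℂ :=
  MvPolynomial.eval (Sum.elim (fun i => z i) (fun i => conj (z i))) P

/-- The (complex) Laplacian `∑ i, ∂² / ∂z_i ∂(conj z_i)`, which is a quarter of the Laplacian of
`ℝ^(2d)`. -/
def laplacian (d : ℕ) : Poly d →ₗ[ℂ] Poly d :=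
  ∑ i : Fin d,
    (MvPolynomial.pderiv (R := ℂ) (Sum.inl i : Fin d ⊕ Fin d)).toLinearMap ∘ₗ
      (MvPolynomial.pderiv (R := ℂ) (Sum.inr i : Fin d ⊕ Fin d)).toLinearMap

/-- `H(p,q)`: the harmonic polynomials on `ℂ^d` that are homogeneous of degree `p` in
`z_1, …, z_d` and homogeneous of degree `q` in `conj z_1, …, conj z_d`. -/
def H (d p q : ℕ) : Submodule ℂ (Poly d) :=
  MvPolynomial.weightedHomogeneousSubmodule ℂ (Sum.elim (fun _ => 1) (fun _ => 0)) p ⊓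
    MvPolynomial.weightedHomogeneousSubmodule ℂ (Sum.elim (fun _ => 0) (fun _ => 1)) q ⊓
      LinearMap.ker (laplacian d)

/-- `P_τ = ⨁_{(p,q) ∈ τ} H(p,q)`. -/
def polySpace (d : ℕ) (τ : Finset (ℕ × ℕ)) : Submodule ℂ (Poly d) :=
  ⨆ pq ∈ τ, H d pq.1 pq.2

/-- The complex Gegenbauer polynomial `Q_{pq}^{(d)}` as a function of `z`
(a polynomial in `z` and `conj z`), for `d ≥ 1`. The case `p = q = 0` is separated since for
`d = 1` the general expression reads `0 · (-1)!` there, whose meaning is `0! = 1`; for `d ≥ 2` it is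
no exception, see `Q_formula`. -/
def Q (d p q : ℕ) (z : ℂ) : ℂ :=
  if p = 0 ∧ q = 0 then 1 else
    ((p + q + d - 1 : ℕ) : ℂ) / ((d - 1)! : ℂ) *
      ∑ j ∈ Finset.range (min p q + 1),
        (-1) ^ j * ((d + p + q - j - 2)! : ℂ) / ((j ! : ℂ) * ((p - j)! : ℂ) * ((q - j)! : ℂ)) *
          z ^ (p - j) * conj z ^ (q - j)

theorem Q_formula (d p q : ℕ) (hd : 2 ≤ d) (z : ℂ) :
    Q d p q z = ((p + q + d - 1 : ℕ) : ℂ) / ((d - 1)! : ℂ) *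
      ∑ j ∈ Finset.range (min p q + 1),
        (-1) ^ j * ((d + p + q - j - 2)! : ℂ) / ((j ! : ℂ) * ((p - j)! : ℂ) * ((q - j)! : ℂ)) *
          z ^ (p - j) * conj z ^ (q - j) := by
  unfold Q
  split_ifs with h
  · obtain ⟨rfl, rfl⟩ := h
    obtain ⟨k, rfl⟩ := Nat.exists_eq_add_of_le' hd
    have h1 : ((k + 1 : ℕ) : ℂ) ≠ 0 := Nat.cast_ne_zero.mpr (Nat.succ_ne_zero k)
    have h2 : ((k ! : ℕ) : ℂ) ≠ 0 := Nat.cast_ne_zero.mpr (Nat.factorial_ne_zero k)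
    have h3 : (((k + 1)! : ℕ) : ℂ) = ((k + 1 : ℕ) : ℂ) * ((k ! : ℕ) : ℂ) := by
      rw [Nat.factorial_succ, Nat.cast_mul]
    simp only [Nat.min_self, zero_add, Finset.sum_range_one]
    rw [show k + 2 - 1 = k + 1 by omega, show k + 2 + 0 + 0 - 0 - 2 = k by omega, h3]
    simp only [pow_zero, Nat.sub_zero, Nat.factorial_zero, Nat.cast_one]
    field_simp
  · rfl

/-- `F = ∑ f_{pq} Q_{pq}`, for a finitely supported family of coefficients. -/
def expansion (d : ℕ) (f : ℕ × ℕ →₀ ℂ) (z : ℂ) : ℂ :=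
  f.sum fun pq c => c * Q d pq.1 pq.2 z

/-- `X = (v_j)` is a spherical `τ`-design: averaging over the `n` unit vectors `v_j` gives the mean
value over the unit sphere (for normalised surface measure) of every polynomial in `P_τ`. -/
def IsDesign {d n : ℕ} (τ : Finset (ℕ × ℕ)) (v : Fin n → Cd d) : Prop :=
  (∀ j, ‖v j‖ = 1) ∧
    ∀ P ∈ polySpace d τ,
      ⨍ z : Metric.sphere (0 : Cd d) 1, evalAt P (z : Cd d)
          ∂((MeasureTheory.volume : MeasureTheory.Measure (Cd d)).toSphere) =
        (1 / (n : ℂ)) * ∑ j, evalAt P (v j)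

/-- `X = (v_j)` is an `A`-code: the inner products `⟨v_j, v_k⟩`, `j ≠ k`, all lie in `A`. -/
def IsCode {d n : ℕ} (A : Set ℂ) (v : Fin n → Cd d) : Prop :=
  ∀ j k, j ≠ k → ip (v j) (v k) ∈ A

end ComplexDesign

end

/-!
On the unit sphere `Q_{pq}(⟨z, w⟩)` is the restriction of a polynomial `zonal d p q w ∈ H(p,q)` in
`z`: the homogenisation of `Q_{pq}` by powers of `|z|²` is harmonic because its coefficients satisfy
a two-term recursion (`zonalCoeff_succ`, `zonal_mem_H`). Hence the matrix `M = [F(⟨v_j, v_k⟩)]`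
factors as

  `ℂⁿ → ⨁_{(p,q) ∈ τ} H(p,q) → ℂⁿ`,

where `synthesis` sends `c` to the family of the `f_{pq} ∑ k, c_k zonal d p q v_k`, and `sampling`
evaluates the sum of a family at the points `v_j` (`mulVecLin_eq_sampling_comp_synthesis`). This
bounds the rank. For an `A`-code `M` is the identity, so the rank is `n`.

If `n` is the dimension of the middle space, the two factors are inverse to each other in both
orders (`synthesis_sampling`). The trace of the diagonal block at `(p,q)` of
`synthesis ∘ sampling` then gives `dim H(p,q) = n f_{pq} Q_{pq}(1)`, and as
`Q_{pq}(1) = dim H(p,q)` (`Q_one`) all coefficients with `H(p,q) ≠ 0` are `1 / n`. Conversely,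
evaluating the identity `F = (1/n) ∑ Q_{pq}` at `1` gives `n = ∑ dim H(p,q)`. If `(0,0) ∈ τ`,
the blocks into `H(0,0)` show that the sample means of the other `H(p,q)` vanish, as the spherical
means do (`integral_sphere_eq_zero`); if `(0,0) ∉ τ`, a design would have vanishing sample means on
all of `P_τ`, against the surjectivity of `sampling`.

Two facts about harmonic polynomials enter. The dimension of `H(p,q)` follows from the surjectivity
of the Laplacian from bidegree `(p+1, q+1)` to bidegree `(p, q)`, since the Laplacian is injective
on the multiples of `|z|²` (`laplacian_normSqPoly_mul_injective`, by the commutation relation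
`laplacian_normSqPoly_mul`). The spherical mean of a nonconstant harmonic `P` is, in polar
coordinates, a multiple of its Gaussian integral, which vanishes by Euler's identity and integration
by parts (`gaussianIntegral_eq_zero`).
-/

noncomputable section

namespace ComplexDesign

open MvPolynomial MeasureTheory

variable {d p q : ℕ}

/-! ### Bihomogeneous polynomials and the Laplacian -/

/-- The weight counting the degree in the variables `z_i`. -/
abbrev holWeight (d : ℕ) : Fin d ⊕ Fin d → ℕ := Sum.elim (fun _ => 1) (fun _ => 0)

/-- The weight counting the degree in the variables `conj z_i`. -/
abbrev antiWeight (d : ℕ) : Fin d ⊕ Fin d → ℕ := Sum.elim (fun _ => 0) (fun _ => 1)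

/-- The polynomials homogeneous of degree `p` in the `z_i` and of degree `q` in the `conj z_i`. -/
def bihomogeneous (d p q : ℕ) : Submodule ℂ (Poly d) :=
  weightedHomogeneousSubmodule ℂ (holWeight d) p ⊓ weightedHomogeneousSubmodule ℂ (antiWeight d) q

/-- The polynomial `∑ i, z_i * conj z_i`, which represents the squared norm. -/
def normSqPoly (d : ℕ) : Poly d := ∑ i : Fin d, X (Sum.inl i) * X (Sum.inr i)

theorem mem_H {P : Poly d} : P ∈ H d p q ↔ P ∈ bihomogeneous d p q ∧ laplacian d P = 0 :=
  Iff.rfl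

theorem laplacian_apply (P : Poly d) :
    laplacian d P = ∑ i : Fin d, pderiv (Sum.inl i) (pderiv (Sum.inr i) P) := by
  simp [laplacian]

theorem sum_inl_mul_pderiv {P : Poly d} (h : P ∈ bihomogeneous d p q) :
    ∑ i : Fin d, X (Sum.inl i) * pderiv (Sum.inl i) P = (p : ℂ) • P := by
  have := IsWeightedHomogeneous.sum_weight_X_mul_pderiv h.1
  simpa [Fintype.sum_sum_type, ← Nat.cast_smul_eq_nsmul ℂ] using this

theorem sum_inr_mul_pderiv {P : Poly d} (h : P ∈ bihomogeneous d p q) :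
    ∑ i : Fin d, X (Sum.inr i) * pderiv (Sum.inr i) P = (q : ℂ) • P := by
  have := IsWeightedHomogeneous.sum_weight_X_mul_pderiv h.2
  simpa [Fintype.sum_sum_type, ← Nat.cast_smul_eq_nsmul ℂ] using this

theorem bihomogeneous_mul {P R : Poly d} {p' q' : ℕ} (hP : P ∈ bihomogeneous d p q)
    (hR : R ∈ bihomogeneous d p' q') : P * R ∈ bihomogeneous d (p + p') (q + q') :=
  ⟨IsWeightedHomogeneous.mul hP.1 hR.1, IsWeightedHomogeneous.mul hP.2 hR.2⟩

theorem bihomogeneous_pow {P : Poly d} (hP : P ∈ bihomogeneous d p q) (k : ℕ) :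
    P ^ k ∈ bihomogeneous d (k * p) (k * q) :=
  ⟨IsWeightedHomogeneous.pow hP.1 k, IsWeightedHomogeneous.pow hP.2 k⟩

theorem X_inl_mem (i : Fin d) : (X (Sum.inl i) : Poly d) ∈ bihomogeneous d 1 0 :=
  ⟨isWeightedHomogeneous_X ℂ (holWeight d) (Sum.inl i),
    isWeightedHomogeneous_X ℂ (antiWeight d) (Sum.inl i)⟩

theorem X_inr_mem (i : Fin d) : (X (Sum.inr i) : Poly d) ∈ bihomogeneous d 0 1 :=
  ⟨isWeightedHomogeneous_X ℂ (holWeight d) (Sum.inr i),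
    isWeightedHomogeneous_X ℂ (antiWeight d) (Sum.inr i)⟩

theorem normSqPoly_mem : normSqPoly d ∈ bihomogeneous d 1 1 :=
  Submodule.sum_mem _ fun i _ => bihomogeneous_mul (X_inl_mem i) (X_inr_mem i)

theorem laplacian_mem {P : Poly d} (h : P ∈ bihomogeneous d (p + 1) (q + 1)) :
    laplacian d P ∈ bihomogeneous d p q := by
  rw [laplacian_apply]
  exact Submodule.sum_mem _ fun i _ =>
    ⟨(IsWeightedHomogeneous.pderiv (i := Sum.inr i) (n' := p + 1) h.1 rfl).pderiv rfl,
      (IsWeightedHomogeneous.pderiv (i := Sum.inr i) (n' := q) h.2 rfl).pderiv rfl⟩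

/-- A derivative in a variable of positive weight kills the polynomials of weight zero. -/
theorem pderiv_eq_zero_of_weight_zero {σ : Type*} {w : σ → ℕ} {P : MvPolynomial σ ℂ}
    (h : P.IsWeightedHomogeneous w 0) {i : σ} (hi : w i ≠ 0) : pderiv i P = 0 := by
  apply pderiv_eq_zero_of_notMem_vars
  intro hmem
  obtain ⟨m, hm, him⟩ := (mem_vars_iff_mem_support i).1 hmem
  have h0 := h (mem_support_iff.1 hm)
  have := Finsupp.le_weight_of_ne_zero (w := w) (s := i) (fun _ => Nat.zero_le _)
    (Finsupp.mem_support_iff.1 him)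
  omega

theorem laplacian_eq_zero_left {P : Poly d} (h : P ∈ bihomogeneous d 0 q) :
    laplacian d P = 0 := by
  rw [laplacian_apply]
  refine Finset.sum_eq_zero fun i _ => pderiv_eq_zero_of_weight_zero (w := holWeight d) ?_ (by simp)
  exact IsWeightedHomogeneous.pderiv (i := Sum.inr i) h.1 rfl

theorem laplacian_eq_zero_right {P : Poly d} (h : P ∈ bihomogeneous d p 0) :
    laplacian d P = 0 := by
  rw [laplacian_apply]
  refine Finset.sum_eq_zero fun i _ => ?_
  rw [pderiv_eq_zero_of_weight_zero (i := Sum.inr i) h.2 (by simp), map_zero]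

theorem pderiv_inl_normSqPoly (i : Fin d) :
    pderiv (Sum.inl i) (normSqPoly d) = X (Sum.inr i) := by
  simp [normSqPoly, pderiv_X, Pi.single_apply]

theorem pderiv_inr_normSqPoly (i : Fin d) :
    pderiv (Sum.inr i) (normSqPoly d) = X (Sum.inl i) := by
  simp [normSqPoly, pderiv_X, Pi.single_apply]

/-- The commutation relation of the Laplacian with multiplication by the squared norm. -/
theorem laplacian_normSqPoly_mul {P : Poly d} (h : P ∈ bihomogeneous d p q) :
    laplacian d (normSqPoly d * P) =
      normSqPoly d * laplacian d P + ((p + q + d : ℕ) : ℂ) • P := by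
  have h1 := sum_inl_mul_pderiv h
  have h2 := sum_inr_mul_pderiv h
  have : ∀ i : Fin d, pderiv (Sum.inl i) (pderiv (Sum.inr i) (normSqPoly d * P)) =
      normSqPoly d * pderiv (Sum.inl i) (pderiv (Sum.inr i) P) +
        X (Sum.inr i) * pderiv (Sum.inr i) P + X (Sum.inl i) * pderiv (Sum.inl i) P + P := by
    intro i
    simp only [Derivation.leibniz, map_add, smul_eq_mul, pderiv_inl_normSqPoly,
      pderiv_inr_normSqPoly, pderiv_X_self]
    ring
  simp only [laplacian_apply, this, Finset.sum_add_distrib, h1, h2, Finset.sum_const,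
    Finset.card_univ, Fintype.card_fin, ← Finset.mul_sum, ← Nat.cast_smul_eq_nsmul ℂ]
  push_cast
  simp only [add_smul]
  ring

theorem laplacian_normSqPoly_pow_mul {P : Poly d} (h : P ∈ bihomogeneous d p q) (j : ℕ) :
    laplacian d (normSqPoly d ^ (j + 1) * P) =
      normSqPoly d ^ (j + 1) * laplacian d P +
        (((j + 1) * (p + q + d + j) : ℕ) : ℂ) • (normSqPoly d ^ j * P) := by
  induction j with
  | zero => simpa using laplacian_normSqPoly_mul h
  | succ j ih =>
    have hm := bihomogeneous_mul (bihomogeneous_pow normSqPoly_mem (j + 1)) h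
    rw [pow_succ', mul_assoc, laplacian_normSqPoly_mul hm, ih]
    simp only [smul_eq_C_mul]
    push_cast
    simp only [map_add, map_mul, map_one]
    ring

/-- The operator `P ↦ |z|² ΔP` has no negative integral eigenvalue. If `P` were an eigenvector,
the commutation relation would make `ΔP` an eigenvector of lower degree, again for a negative
eigenvalue. -/
theorem eq_zero_of_normSqPoly_mul_laplacian {P : Poly d} (h : P ∈ bihomogeneous d p q) {c : ℕ}
    (hc : 0 < c) (hP : normSqPoly d * laplacian d P = -(c : ℂ) • P) : P = 0 := by
  induction p generalizing q P c with
  | zero =>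
    rw [laplacian_eq_zero_left h, mul_zero] at hP
    exact (smul_eq_zero.1 hP.symm).resolve_left (by simpa using hc.ne')
  | succ p ih =>
    cases q with
    | zero =>
      rw [laplacian_eq_zero_right h, mul_zero] at hP
      exact (smul_eq_zero.1 hP.symm).resolve_left (by simpa using hc.ne')
    | succ q =>
      have hm := laplacian_mem h
      have h2 := congrArg (laplacian d) hP
      rw [laplacian_normSqPoly_mul hm, map_smul] at h2
      have h0 : laplacian d P = 0 := by
        refine ih hm (c := c + (p + q + d)) (by omega) ?_
        rw [eq_sub_of_add_eq h2, ← sub_smul]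
        congr 1
        push_cast
        ring
      rw [h0, mul_zero] at hP
      exact (smul_eq_zero.1 hP.symm).resolve_left (by simpa using hc.ne')

/-- Multiplication by the squared norm followed by the Laplacian is injective: a kernel element
would be an eigenvector of `P ↦ |z|² ΔP` for the eigenvalue `-(p + q + d)`. -/
theorem laplacian_normSqPoly_mul_injective (hd : 1 ≤ d) {P : Poly d}
    (h : P ∈ bihomogeneous d p q) (hP : laplacian d (normSqPoly d * P) = 0) : P = 0 := by
  rw [laplacian_normSqPoly_mul h] at hP
  refine eq_zero_of_normSqPoly_mul_laplacian h (c := p + q + d) (by omega) ?_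
  rw [eq_neg_of_add_eq_zero_left hP, neg_smul]

/-! ### Evaluation and the zonal polynomials -/

/-- Evaluation of polynomials at a point of `ℂ^d`, as an algebra homomorphism. -/
def evalHom (z : Cd d) : Poly d →ₐ[ℂ] ℂ :=
  aeval (Sum.elim (fun i => z i) (fun i => conj (z i)))

theorem evalHom_apply (z : Cd d) (P : Poly d) : evalHom z P = evalAt P z := by
  rw [evalHom, evalAt, aeval_eq_eval]

@[simp]
theorem evalHom_X_inl (z : Cd d) (i : Fin d) : evalHom z (X (Sum.inl i)) = z i := by
  simp [evalHom]

@[simp]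
theorem evalHom_X_inr (z : Cd d) (i : Fin d) : evalHom z (X (Sum.inr i)) = conj (z i) := by
  simp [evalHom]

theorem ip_self {z : Cd d} (hz : ‖z‖ = 1) : ip z z = 1 := by
  simp [ip, inner_self_eq_norm_sq_to_K, hz]

theorem evalHom_normSqPoly {z : Cd d} (hz : ‖z‖ = 1) : evalHom z (normSqPoly d) = 1 := by
  rw [← ip_self hz, ip_eq_sum]
  simp [normSqPoly]

/-- The linear form `z ↦ ⟨z, w⟩`, as a polynomial. -/
def ipPoly (w : Cd d) : Poly d := ∑ i : Fin d, C (conj (w i)) * X (Sum.inl i)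

/-- The antilinear form `z ↦ conj ⟨z, w⟩`, as a polynomial. -/
def conjIpPoly (w : Cd d) : Poly d := ∑ i : Fin d, C (w i) * X (Sum.inr i)

theorem ipPoly_mem (w : Cd d) : ipPoly w ∈ bihomogeneous d 1 0 :=
  Submodule.sum_mem _ fun i _ => by
    rw [← smul_eq_C_mul]
    exact Submodule.smul_mem _ _ (X_inl_mem i)

theorem conjIpPoly_mem (w : Cd d) : conjIpPoly w ∈ bihomogeneous d 0 1 :=
  Submodule.sum_mem _ fun i _ => by
    rw [← smul_eq_C_mul]
    exact Submodule.smul_mem _ _ (X_inr_mem i)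

theorem ipPoly_pow_mul_mem (w : Cd d) (a b : ℕ) :
    ipPoly w ^ a * conjIpPoly w ^ b ∈ bihomogeneous d a b := by
  simpa using bihomogeneous_mul (bihomogeneous_pow (ipPoly_mem w) a)
    (bihomogeneous_pow (conjIpPoly_mem w) b)

theorem evalHom_ipPoly (z w : Cd d) : evalHom z (ipPoly w) = ip z w := by
  rw [ip_eq_sum, ipPoly, map_sum]
  refine Finset.sum_congr rfl fun i _ => ?_
  rw [← smul_eq_C_mul, map_smul, evalHom_X_inl, smul_eq_mul, mul_comm]

theorem evalHom_conjIpPoly (z w : Cd d) : evalHom z (conjIpPoly w) = conj (ip z w) := by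
  rw [ip_eq_sum, conjIpPoly, map_sum, map_sum]
  refine Finset.sum_congr rfl fun i _ => ?_
  rw [← smul_eq_C_mul, map_smul, evalHom_X_inr, smul_eq_mul, map_mul, Complex.conj_conj, mul_comm]

theorem laplacian_ipPoly_pow_mul {w : Cd d} (hw : ‖w‖ = 1) (a b : ℕ) :
    laplacian d (ipPoly w ^ a * conjIpPoly w ^ b) =
      ((a * b : ℕ) : ℂ) • (ipPoly w ^ (a - 1) * conjIpPoly w ^ (b - 1)) := by
  have h1 : ∀ i : Fin d, pderiv (Sum.inl i) (ipPoly w) = C (conj (w i)) := fun i => by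
    simp [ipPoly, pderiv_X, Pi.single_apply]
  have h2 : ∀ i : Fin d, pderiv (Sum.inr i) (ipPoly w) = 0 := fun i => by
    simp [ipPoly, pderiv_X]
  have h3 : ∀ i : Fin d, pderiv (Sum.inr i) (conjIpPoly w) = C (w i) := fun i => by
    simp [conjIpPoly, pderiv_X, Pi.single_apply]
  have h4 : ∀ i : Fin d, pderiv (Sum.inl i) (conjIpPoly w) = 0 := fun i => by
    simp [conjIpPoly, pderiv_X]
  have h5 : (∑ i : Fin d, C (w i * conj (w i)) : Poly d) = 1 := by
    rw [← map_sum, ← ip_eq_sum, ip_self hw, C_1]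
  have : ∀ i : Fin d, pderiv (Sum.inl i) (pderiv (Sum.inr i) (ipPoly w ^ a * conjIpPoly w ^ b)) =
      C (w i * conj (w i)) *
        (((a * b : ℕ) : ℂ) • (ipPoly w ^ (a - 1) * conjIpPoly w ^ (b - 1))) := by
    intro i
    simp only [Derivation.leibniz, Derivation.leibniz_pow, h1, h2, h3, h4, pderiv_C, smul_eq_mul,
      smul_zero, mul_zero, add_zero, zero_add, nsmul_eq_mul, map_mul, Derivation.map_natCast]
    rw [smul_eq_C_mul, map_natCast]
    push_cast
    ring
  rw [laplacian_apply, Finset.sum_congr rfl fun i _ => this i, ← Finset.sum_mul, h5, one_mul]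

/-- The coefficients of `Q_{pq}`, up to a factor which does not depend on `j`. -/
def zonalCoeff (d p q j : ℕ) : ℂ :=
  (-1) ^ j * ((d + p + q - j - 2)! : ℂ) / ((j ! : ℂ) * ((p - j)! : ℂ) * ((q - j)! : ℂ))

/-- The two-term recursion that makes the zonal polynomials harmonic. -/
theorem zonalCoeff_succ (hd : 1 ≤ d) {j : ℕ} (hp : j < p) (hq : j < q) :
    zonalCoeff d p q (j + 1) * (((j + 1) * (p + q + d - 1 - (j + 1)) : ℕ) : ℂ) =
      -(zonalCoeff d p q j * (((p - j) * (q - j) : ℕ) : ℂ)) := by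
  obtain ⟨a, rfl⟩ := Nat.exists_eq_add_of_lt hp
  obtain ⟨b, rfl⟩ := Nat.exists_eq_add_of_lt hq
  obtain ⟨e, rfl⟩ := Nat.exists_eq_add_of_le' hd
  unfold zonalCoeff
  rw [show e + 1 + (j + a + 1) + (j + b + 1) - (j + 1) - 2 = e + j + a + b by omega,
    show e + 1 + (j + a + 1) + (j + b + 1) - j - 2 = e + j + a + b + 1 by omega,
    show j + a + 1 + (j + b + 1) + (e + 1) - 1 - (j + 1) = e + j + a + b + 1 by omega,
    show j + a + 1 - (j + 1) = a by omega, show j + b + 1 - (j + 1) = b by omega,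
    show j + a + 1 - j = a + 1 by omega, show j + b + 1 - j = b + 1 by omega]
  have ha := Nat.cast_ne_zero (R := ℂ).2 (Nat.factorial_ne_zero a)
  have hb := Nat.cast_ne_zero (R := ℂ).2 (Nat.factorial_ne_zero b)
  have hj := Nat.cast_ne_zero (R := ℂ).2 (Nat.factorial_ne_zero j)
  have ha1 : (a : ℂ) + 1 ≠ 0 := Nat.cast_add_one_ne_zero a
  have hb1 : (b : ℂ) + 1 ≠ 0 := Nat.cast_add_one_ne_zero b
  have hj1 : (j : ℂ) + 1 ≠ 0 := Nat.cast_add_one_ne_zero j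
  simp only [Nat.factorial_succ]
  push_cast
  field_simp
  ring

/-- The zonal harmonic with pole `w`: the homogenisation of `z ↦ Q_{pq}(⟨z, w⟩)` by powers of the
squared norm. -/
def zonal (d p q : ℕ) (w : Cd d) : Poly d :=
  if p = 0 ∧ q = 0 then 1 else
    (((p + q + d - 1 : ℕ) : ℂ) / ((d - 1)! : ℂ)) •
      ∑ j ∈ Finset.range (min p q + 1),
        zonalCoeff d p q j • (normSqPoly d ^ j * (ipPoly w ^ (p - j) * conjIpPoly w ^ (q - j)))

theorem evalHom_zonal {z : Cd d} (hz : ‖z‖ = 1) (w : Cd d) (p q : ℕ) :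
    evalHom z (zonal d p q w) = Q d p q (ip z w) := by
  unfold zonal Q
  split_ifs
  · simp
  · simp only [map_smul, map_sum, map_mul, map_pow, evalHom_normSqPoly hz, evalHom_ipPoly,
      evalHom_conjIpPoly, smul_eq_mul, one_pow, one_mul, zonalCoeff, mul_assoc]

theorem laplacian_zonal_term {w : Cd d} (hw : ‖w‖ = 1) {j : ℕ} (hp : j ≤ p) (hq : j ≤ q) :
    laplacian d (normSqPoly d ^ j * (ipPoly w ^ (p - j) * conjIpPoly w ^ (q - j))) =
      (((p - j) * (q - j) : ℕ) : ℂ) •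
          (normSqPoly d ^ j * (ipPoly w ^ (p - (j + 1)) * conjIpPoly w ^ (q - (j + 1)))) +
        ((j * (p + q + d - 1 - j) : ℕ) : ℂ) •
          (normSqPoly d ^ (j - 1) * (ipPoly w ^ (p - j) * conjIpPoly w ^ (q - j))) := by
  cases j with
  | zero => simp [laplacian_ipPoly_pow_mul hw]
  | succ j =>
    rw [laplacian_normSqPoly_pow_mul (ipPoly_pow_mul_mem w _ _), laplacian_ipPoly_pow_mul hw,
      mul_smul_comm]
    congr 4
    omega

theorem zonal_mem_H (hd : 1 ≤ d) {w : Cd d} (hw : ‖w‖ = 1) (p q : ℕ) :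
    zonal d p q w ∈ H d p q := by
  unfold zonal
  split_ifs with h
  · obtain ⟨rfl, rfl⟩ := h
    exact ⟨⟨isWeightedHomogeneous_one ℂ _, isWeightedHomogeneous_one ℂ _⟩, by
      simp [laplacian_apply]⟩
  refine Submodule.smul_mem _ _ (mem_H.2 ⟨Submodule.sum_mem _ fun j hj => ?_, ?_⟩)
  · have hj' : j ≤ p ∧ j ≤ q := by
      rw [Finset.mem_range] at hj
      omega
    have := bihomogeneous_mul (bihomogeneous_pow normSqPoly_mem j)
      (ipPoly_pow_mul_mem w (p - j) (q - j))
    rw [mul_one, Nat.add_sub_cancel' hj'.1, Nat.add_sub_cancel' hj'.2] at this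
    exact Submodule.smul_mem _ _ this
  · have h1 : ∀ j ∈ Finset.range (min p q + 1),
        laplacian d (zonalCoeff d p q j •
          (normSqPoly d ^ j * (ipPoly w ^ (p - j) * conjIpPoly w ^ (q - j)))) =
        (zonalCoeff d p q j * (((p - j) * (q - j) : ℕ) : ℂ)) •
          (normSqPoly d ^ j * (ipPoly w ^ (p - (j + 1)) * conjIpPoly w ^ (q - (j + 1)))) +
        (zonalCoeff d p q j * ((j * (p + q + d - 1 - j) : ℕ) : ℂ)) •
          (normSqPoly d ^ (j - 1) * (ipPoly w ^ (p - j) * conjIpPoly w ^ (q - j))) := by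
      intro j hj
      rw [Finset.mem_range] at hj
      rw [map_smul, laplacian_zonal_term hw (by omega) (by omega), smul_add, smul_smul, smul_smul]
    -- The contributions of neighbouring terms to each power of the squared norm cancel.
    have h2 : (p - min p q) * (q - min p q) = 0 := by
      rcases le_total p q with hpq | hpq <;> simp [hpq]
    rw [map_sum, Finset.sum_congr rfl h1, Finset.sum_add_distrib, Finset.sum_range_succ, h2,
      Finset.sum_range_succ' (n := min p q)]
    simp only [Nat.cast_zero, mul_zero, zero_smul, add_zero, zero_mul, Nat.add_sub_cancel]
    rw [← Finset.sum_add_distrib]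
    refine Finset.sum_eq_zero fun j hj => ?_
    rw [Finset.mem_range] at hj
    rw [← add_smul, zonalCoeff_succ hd (by omega) (by omega), add_neg_cancel, zero_smul]

/-! ### The dimension of `H(p,q)` -/

theorem weight_holWeight (m : Fin d ⊕ Fin d →₀ ℕ) :
    Finsupp.weight (holWeight d) m = ∑ i, m (Sum.inl i) := by
  simp [Finsupp.weight_apply, Finsupp.sum_fintype, Fintype.sum_sum_type]

theorem weight_antiWeight (m : Fin d ⊕ Fin d →₀ ℕ) :
    Finsupp.weight (antiWeight d) m = ∑ i, m (Sum.inr i) := by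
  simp [Finsupp.weight_apply, Finsupp.sum_fintype, Fintype.sum_sum_type]

theorem bihomogeneous_eq_restrictSupport :
    bihomogeneous d p q = restrictSupport ℂ
      {m | Finsupp.weight (holWeight d) m = p ∧ Finsupp.weight (antiWeight d) m = q} := by
  ext P
  simp only [bihomogeneous, Submodule.mem_inf, mem_weightedHomogeneousSubmodule,
    IsWeightedHomogeneous, mem_restrictSupport_iff, Set.subset_def, Finset.mem_coe, mem_support_iff,
    Set.mem_ofPred_eq]
  exact ⟨fun h m hm => ⟨h.1 hm, h.2 hm⟩, fun h => ⟨fun m hm => (h m hm).1, fun m hm => (h m hm).2⟩⟩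

/-- The exponents of the monomials of bidegree `(p, q)` are the pairs of an exponent of degree `p`
in the `z_i` and one of degree `q` in the `conj z_i`. -/
def exponentEquiv (d p q : ℕ) :
    {m : Fin d ⊕ Fin d →₀ ℕ |
        Finsupp.weight (holWeight d) m = p ∧ Finsupp.weight (antiWeight d) m = q} ≃
      (Finset.finsuppAntidiag (Finset.univ : Finset (Fin d)) p) ×
        (Finset.finsuppAntidiag (Finset.univ : Finset (Fin d)) q) :=
  (Finsupp.sumFinsuppEquivProdFinsupp.subtypeEquiv fun m => by
      simp only [Set.mem_ofPred_eq, weight_holWeight, weight_antiWeight, Finset.mem_finsuppAntidiag,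
        Finset.subset_univ, and_true]
      rfl).trans
    (Equiv.subtypeProdEquivProd (p := (· ∈ Finset.finsuppAntidiag Finset.univ p))
      (q := (· ∈ Finset.finsuppAntidiag Finset.univ q)))

instance : FiniteDimensional ℂ (bihomogeneous d p q) := by
  have : Finite {m : Fin d ⊕ Fin d →₀ ℕ |
      Finsupp.weight (holWeight d) m = p ∧ Finsupp.weight (antiWeight d) m = q} :=
    Finite.of_equiv _ (exponentEquiv d p q).symm
  rw [bihomogeneous_eq_restrictSupport]
  exact Module.Finite.of_basis (basisRestrictSupport ℂ _)

instance : FiniteDimensional ℂ (H d p q) :=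
  Submodule.finiteDimensional_of_le (fun _ h => (mem_H.1 h).1 : H d p q ≤ bihomogeneous d p q)

theorem finrank_bihomogeneous :
    Module.finrank ℂ (bihomogeneous d p q) = (d + p - 1).choose p * (d + q - 1).choose q := by
  rw [bihomogeneous_eq_restrictSupport, Module.finrank_eq_nat_card_basis (basisRestrictSupport ℂ _),
    Nat.card_congr (exponentEquiv d p q), Nat.card_prod]
  simp only [Nat.card_eq_fintype_card, Fintype.card_coe, Finset.card_finsuppAntidiag_nat_eq_choose,
    Finset.card_univ, Fintype.card_fin]

/-- Rank-nullity for the Laplacian, which is onto because its composition with multiplication by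
the squared norm is injective. -/
theorem finrank_H_succ_add (hd : 1 ≤ d) :
    Module.finrank ℂ (bihomogeneous d p q) + Module.finrank ℂ (H d (p + 1) (q + 1)) =
      Module.finrank ℂ (bihomogeneous d (p + 1) (q + 1)) := by
  let L : bihomogeneous d (p + 1) (q + 1) →ₗ[ℂ] bihomogeneous d p q :=
    (laplacian d).restrict fun P hP => laplacian_mem hP
  let R : bihomogeneous d p q →ₗ[ℂ] bihomogeneous d (p + 1) (q + 1) :=
    (LinearMap.mulLeft ℂ (normSqPoly d)).restrict fun P hP => by
      simpa [add_comm] using bihomogeneous_mul normSqPoly_mem hP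
  have hinj : Function.Injective (L ∘ₗ R) := by
    rw [← LinearMap.ker_eq_bot, LinearMap.ker_eq_bot']
    intro P hP
    exact Subtype.ext (laplacian_normSqPoly_mul_injective hd P.2 (congrArg Subtype.val hP))
  have hsurj : Function.Surjective L :=
    Function.Surjective.of_comp (g := R) (LinearMap.injective_iff_surjective.1 hinj)
  have hker : (LinearMap.ker L).map (bihomogeneous d (p + 1) (q + 1)).subtype =
      H d (p + 1) (q + 1) := by
    ext P
    simp only [Submodule.mem_map, LinearMap.mem_ker, Submodule.subtype_apply, mem_H]
    constructor
    · rintro ⟨P, hP, rfl⟩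
      exact ⟨P.2, congrArg Subtype.val hP⟩
    · rintro ⟨h1, h2⟩
      exact ⟨⟨P, h1⟩, Subtype.ext h2, rfl⟩
  rw [← hker, Submodule.finrank_map_subtype_eq, ← LinearMap.finrank_range_add_finrank_ker L,
    LinearMap.range_eq_top.2 hsurj, finrank_top]

theorem H_eq_bihomogeneous (h : p = 0 ∨ q = 0) : H d p q = bihomogeneous d p q := by
  refine le_antisymm (fun P hP => (mem_H.1 hP).1) fun P hP => mem_H.2 ⟨hP, ?_⟩
  rcases h with rfl | rfl
  · exact laplacian_eq_zero_left hP
  · exact laplacian_eq_zero_right hP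

/-- The coefficient of `x ^ q` in `(1 - x) ^ p * (1 - x) ^ (-(m + p + 1)) = (1 - x) ^ (-(m + 1))`,
where `N = m + p + q`. -/
theorem sum_neg_one_pow_mul_choose_mul_choose (p q N : ℕ) (h : p ≤ N) :
    ∑ j ∈ Finset.range (q + 1), (-1 : ℤ) ^ j * p.choose j * (N - j).choose (q - j) =
      (N - p).choose q := by
  induction p generalizing q N with
  | zero =>
    rw [Finset.sum_range_succ']
    simp
  | succ p ih =>
    cases q with
    | zero => simp
    | succ q =>
      obtain ⟨N, rfl⟩ := Nat.exists_eq_add_of_le' (show 1 ≤ N by omega)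
      have h1 := ih (q + 1) (N + 1) (by omega)
      have h2 := ih q N (by omega)
      have h3 : (N + 1 - p).choose (q + 1) =
          (N + 1 - (p + 1)).choose q + (N + 1 - (p + 1)).choose (q + 1) := by
        rw [show N + 1 - p = N - p + 1 by omega, Nat.choose_succ_succ,
          show N + 1 - (p + 1) = N - p by omega]
      rw [Finset.sum_range_succ'] at h1 ⊢
      simp only [Nat.choose_succ_succ p, Nat.add_sub_add_right] at h1 ⊢
      have h4 : ∀ j, (-1 : ℤ) ^ (j + 1) * ((p.choose j + p.choose (j + 1) : ℕ) : ℤ) *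
          ((N - j).choose (q - j) : ℤ) =
          (-1 : ℤ) ^ (j + 1) * p.choose (j + 1) * (N - j).choose (q - j) -
            (-1 : ℤ) ^ j * p.choose j * (N - j).choose (q - j) := by
        intro j
        push_cast
        ring
      simp only [h4, Finset.sum_sub_distrib, h2]
      simp only [Nat.choose_zero_right, Nat.sub_zero] at h1 ⊢
      rw [sub_add_eq_add_sub, h1, h3, show N + 1 - (p + 1) = N - p by omega]
      push_cast
      ring

/-- The value of the alternating sum in `Q_{pq}(1)`, for `p ≥ 1`. For `d = 1` and `q = 0` the
truncated subtraction `d + q - 2 = 0` is harmless, since the binomial coefficient is `1`. -/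
theorem sum_zonalCoeff (hd : 1 ≤ d) (hp : 1 ≤ p) :
    ∑ j ∈ Finset.range (min p q + 1), zonalCoeff d p q j =
      ((d + p - 2)! : ℂ) / (p ! : ℂ) * ((d + q - 2).choose q : ℂ) := by
  rcases Nat.eq_zero_or_pos q with rfl | hq0
  · simp [zonalCoeff]
  have key := congrArg (Int.cast : ℤ → ℂ)
    (sum_neg_one_pow_mul_choose_mul_choose p q (d + p + q - 2) (by omega))
  push_cast at key
  rw [show d + p + q - 2 - p = d + q - 2 by omega] at key
  rw [← key, Finset.mul_sum]
  have hsub : Finset.range (min p q + 1) ⊆ Finset.range (q + 1) := by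
    intro j
    simp only [Finset.mem_range]
    omega
  rw [← Finset.sum_subset hsub]
  · refine Finset.sum_congr rfl fun j hj => ?_
    rw [Finset.mem_range] at hj
    have h1 := Nat.choose_mul_factorial_mul_factorial (show j ≤ p by omega)
    have h2 := Nat.choose_mul_factorial_mul_factorial
      (show q - j ≤ d + p + q - 2 - j by omega)
    rw [show d + p + q - 2 - j - (q - j) = d + p - 2 by omega] at h2
    unfold zonalCoeff
    rw [show d + p + q - j - 2 = d + p + q - 2 - j by omega, ← h1, ← h2]
    have hc := Nat.cast_ne_zero (R := ℂ).2 (Nat.choose_pos (show j ≤ p by omega)).ne'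
    have ha := Nat.cast_ne_zero (R := ℂ).2 (Nat.factorial_ne_zero j)
    have hb := Nat.cast_ne_zero (R := ℂ).2 (Nat.factorial_ne_zero (p - j))
    have hq := Nat.cast_ne_zero (R := ℂ).2 (Nat.factorial_ne_zero (q - j))
    push_cast
    field_simp
  · intro j _ hj
    rw [Finset.mem_range] at hj
    have : p < j ∨ q < j := by omega
    rcases this with h | h
    · simp [Nat.choose_eq_zero_of_lt h]
    · simp_all
      omega

theorem Q_one_eq (h : ¬(p = 0 ∧ q = 0)) :
    Q d p q 1 = ((p + q + d - 1 : ℕ) : ℂ) / ((d - 1)! : ℂ) *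
      ∑ j ∈ Finset.range (min p q + 1), zonalCoeff d p q j := by
  simp [Q, h, zonalCoeff]

/-- `Q_{pq}(1) = dim H(p,q)`, by comparing the closed form of the alternating sum with the
difference of the dimensions of the bihomogeneous polynomials. -/
theorem Q_one (hd : 1 ≤ d) (p q : ℕ) : Q d p q 1 = Module.finrank ℂ (H d p q) := by
  obtain ⟨e, rfl⟩ := Nat.exists_eq_add_of_le' hd
  have he := Nat.cast_ne_zero (R := ℂ).2 (Nat.factorial_ne_zero e)
  cases p with
  | zero =>
    rw [H_eq_bihomogeneous (Or.inl rfl), finrank_bihomogeneous]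
    cases q with
    | zero => simp [Q]
    | succ q =>
      have hq := Nat.cast_ne_zero (R := ℂ).2 (Nat.factorial_ne_zero (q + 1))
      rw [Q_one_eq (by simp), show e + 1 + (q + 1) - 1 = q + 1 + e by omega, Nat.choose_zero_right,
        one_mul, Nat.cast_add_choose ℂ]
      simp only [zonalCoeff, Nat.zero_min, zero_add, Finset.sum_range_one]
      rw [show e + 1 + 0 + (q + 1) - 0 - 2 = q + e by omega,
        show q + 1 + (e + 1) - 1 = q + e + 1 by omega,
        show q + 1 + e = q + e + 1 by omega, Nat.factorial_succ (q + e)]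
      simp
      field_simp
  | succ p =>
    have hp := Nat.cast_ne_zero (R := ℂ).2 (Nat.factorial_ne_zero p)
    have hp1 : (p : ℂ) + 1 ≠ 0 := Nat.cast_add_one_ne_zero p
    rw [Q_one_eq (by simp), sum_zonalCoeff hd (by omega)]
    cases q with
    | zero =>
      rw [H_eq_bihomogeneous (Or.inr rfl), finrank_bihomogeneous,
        show e + 1 + (p + 1) - 1 = p + 1 + e by omega, Nat.choose_zero_right, Nat.choose_zero_right,
        mul_one, Nat.cast_add_choose ℂ, show e + 1 + (p + 1) - 2 = p + e by omega,
        show p + 1 + 0 + (e + 1) - 1 = p + e + 1 by omega,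
        show p + 1 + e = p + e + 1 by omega, Nat.factorial_succ (p + e)]
      simp
      field_simp
    | succ q =>
      have hq := Nat.cast_ne_zero (R := ℂ).2 (Nat.factorial_ne_zero q)
      have hq1 : (q : ℂ) + 1 ≠ 0 := Nat.cast_add_one_ne_zero q
      have h1 := congrArg (Nat.cast : ℕ → ℂ) (finrank_H_succ_add (p := p) (q := q) hd)
      simp only [finrank_bihomogeneous] at h1
      have h2 : ((e + q).choose (q + 1) : ℂ) = (e : ℂ) * (e + q)! / ((q + 1)! * e !) := by
        have h3 := Nat.choose_succ_right_eq (e + q) q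
        have h4 := Nat.cast_add_choose ℂ (a := q) (b := e)
        rw [Nat.add_sub_cancel] at h3
        have h5 := congrArg (Nat.cast : ℕ → ℂ) h3
        push_cast at h5
        rw [eq_div_of_mul_eq hq1 h5, add_comm e q, h4, Nat.factorial_succ q]
        push_cast
        field_simp
      rw [show e + 1 + p - 1 = p + e by omega, show e + 1 + q - 1 = q + e by omega,
        show e + 1 + (p + 1) - 1 = p + 1 + e by omega,
        show e + 1 + (q + 1) - 1 = q + 1 + e by omega] at h1
      push_cast at h1
      rw [Nat.cast_add_choose ℂ, Nat.cast_add_choose ℂ, Nat.cast_add_choose ℂ,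
        Nat.cast_add_choose ℂ] at h1
      rw [eq_sub_of_add_eq' h1, show e + 1 + (q + 1) - 2 = e + q by omega, h2,
        show e + 1 + (p + 1) - 2 = p + e by omega,
        show p + 1 + (q + 1) + (e + 1) - 1 = p + q + e + 2 by omega,
        show p + 1 + e = p + e + 1 by omega, show q + 1 + e = q + e + 1 by omega,
        add_comm e q, Nat.add_sub_cancel]
      simp only [Nat.factorial_succ]
      push_cast
      field_simp
      ring

/-! ### Spherical means of harmonic polynomials -/

/-- The Gaussian `exp (-‖z‖²)`, written with the polynomial `normSqPoly` so that it can be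
differentiated by the formula for polynomials. -/
def gaussian (z : Cd d) : ℂ := Complex.exp (-evalHom z (normSqPoly d))

theorem evalHom_normSqPoly_eq (z : Cd d) : evalHom z (normSqPoly d) = ((‖z‖ ^ 2 : ℝ) : ℂ) := by
  rw [EuclideanSpace.norm_sq_eq]
  simp [normSqPoly, Complex.mul_conj, Complex.normSq_eq_norm_sq]

theorem gaussian_eq (z : Cd d) : gaussian z = ((Real.exp (-‖z‖ ^ 2) : ℝ) : ℂ) := by
  simp [gaussian, evalHom_normSqPoly_eq]

theorem continuous_evalHom (P : Poly d) : Continuous fun z : Cd d => evalHom z P := by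
  induction P using MvPolynomial.induction_on with
  | C a => simpa [evalHom] using continuous_const
  | add P R hP hR => simpa using! hP.add hR
  | mul_X P s hP =>
    rcases s with i | i <;> simp only [map_mul, evalHom_X_inl, evalHom_X_inr] <;> fun_prop

theorem continuous_gaussian : Continuous (gaussian : Cd d → ℂ) :=
  (continuous_evalHom _).neg.cexp

theorem integrable_norm_pow_mul_exp [Nontrivial (Cd d)] (k : ℕ) :
    Integrable fun z : Cd d => ‖z‖ ^ k * Real.exp (-‖z‖ ^ 2) := by
  rw [integrable_fun_norm_addHaar volume (f := fun r : ℝ => r ^ k * Real.exp (-r ^ 2))]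
  have hk : (-1 : ℝ) < (Module.finrank ℝ (Cd d) - 1 + k : ℕ) :=
    lt_of_lt_of_le (by norm_num) (Nat.cast_nonneg _)
  have := integrableOn_rpow_mul_exp_neg_mul_sq one_pos hk
  refine this.congr_fun (fun r _ => ?_) measurableSet_Ioi
  simp only [Real.rpow_natCast, smul_eq_mul, pow_add]
  ring_nf

theorem integrable_norm_pow_mul_evalHom_mul_gaussian [Nontrivial (Cd d)] (P : Poly d) (k : ℕ) :
    Integrable fun z : Cd d => ((‖z‖ ^ k : ℝ) : ℂ) * (evalHom z P * gaussian z) := by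
  have hmeas : ∀ (R : Poly d) (k : ℕ), AEStronglyMeasurable
      (fun z : Cd d => ((‖z‖ ^ k : ℝ) : ℂ) * (evalHom z R * gaussian z)) := fun R k => by
    have := continuous_evalHom R
    have := continuous_gaussian (d := d)
    exact Continuous.aestronglyMeasurable (by fun_prop)
  induction P using MvPolynomial.induction_on generalizing k with
  | C a =>
    refine ((integrable_norm_pow_mul_exp k).ofReal.const_mul a).congr (.of_forall fun z => ?_)
    simp [evalHom, gaussian_eq]
    ring
  | add P R hP hR =>
    refine ((hP k).add (hR k)).congr (.of_forall fun z => ?_)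
    simp only [Pi.add_apply, map_add]
    ring
  | mul_X P s hP =>
    refine (hP (k + 1)).mono (hmeas _ _) (.of_forall fun z => ?_)
    have hs : ‖evalHom z (X s)‖ ≤ ‖z‖ := by
      rcases s with i | i
      · rw [evalHom_X_inl]
        exact PiLp.norm_apply_le z i
      · rw [evalHom_X_inr, RCLike.norm_conj]
        exact PiLp.norm_apply_le z i
    simp only [norm_mul, map_mul, Complex.norm_real, norm_pow, norm_norm]
    calc _ = ‖z‖ ^ k * ‖evalHom z P‖ * ‖gaussian z‖ * ‖evalHom z (X s)‖ := by ring
      _ ≤ ‖z‖ ^ k * ‖evalHom z P‖ * ‖gaussian z‖ * ‖z‖ := by gcongr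
      _ = _ := by ring

theorem integrable_evalHom_mul_gaussian [Nontrivial (Cd d)] (P : Poly d) :
    Integrable fun z : Cd d => evalHom z P * gaussian z := by
  simpa using integrable_norm_pow_mul_evalHom_mul_gaussian P 0

/-- The real derivative of a polynomial in the direction `c e_i`, in terms of the formal
derivatives in `z_i` and `conj z_i`. -/
theorem hasLineDerivAt_evalHom (P : Poly d) (z : Cd d) (i : Fin d) (c : ℂ) :
    HasLineDerivAt ℝ (fun z : Cd d => evalHom z P)
      (c * evalHom z (pderiv (Sum.inl i) P) + conj c * evalHom z (pderiv (Sum.inr i) P)) z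
      (EuclideanSpace.single i c) := by
  unfold HasLineDerivAt
  induction P using MvPolynomial.induction_on with
  | C a => simpa [evalHom] using hasDerivAt_const (0 : ℝ) a
  | add P R hP hR =>
    simp only [map_add]
    refine (HasDerivAt.add hP hR).congr_deriv ?_
    ring
  | mul_X P s hP =>
    have hX : HasDerivAt (fun t : ℝ => evalHom (z + t • EuclideanSpace.single i c) (X s : Poly d))
        (c * evalHom z (pderiv (Sum.inl i) (X s)) +
          conj c * evalHom z (pderiv (Sum.inr i) (X s))) 0 := by
      have hlin : ∀ a b : ℂ, HasDerivAt (fun t : ℝ => a + t * b) b 0 := fun a b => by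
        simpa using ((hasDerivAt_id (0 : ℝ)).ofReal_comp.mul_const b).const_add a
      rcases s with j | j
      · by_cases hij : i = j
        · subst hij
          simpa [pderiv_X] using hlin (z i) c
        · simpa [pderiv_X, hij, Ne.symm hij] using hasDerivAt_const (0 : ℝ) (z j)
      · by_cases hij : i = j
        · subst hij
          simpa [pderiv_X] using hlin (conj (z i)) (conj c)
        · simpa [pderiv_X, hij, Ne.symm hij] using hasDerivAt_const (0 : ℝ) (conj (z j))
    simp only [map_mul]
    refine (HasDerivAt.mul hP hX).congr_deriv ?_
    simp only [Derivation.leibniz, smul_eq_mul, map_add, map_mul, zero_smul, add_zero]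
    ring

theorem hasLineDerivAt_gaussian (z : Cd d) (i : Fin d) (c : ℂ) :
    HasLineDerivAt ℝ (gaussian : Cd d → ℂ)
      (-(c * evalHom z (X (Sum.inr i)) + conj c * evalHom z (X (Sum.inl i))) * gaussian z) z
      (EuclideanSpace.single i c) := by
  have h := hasLineDerivAt_evalHom (normSqPoly d) z i c
  rw [pderiv_inl_normSqPoly, pderiv_inr_normSqPoly] at h
  unfold HasLineDerivAt at h ⊢
  refine (HasDerivAt.cexp (HasDerivAt.neg h)).congr_deriv ?_
  simp [gaussian]
  ring

/-- The Gaussian integral, as a linear functional on polynomials. -/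
def gaussianIntegral [Nontrivial (Cd d)] : Poly d →ₗ[ℂ] ℂ where
  toFun P := ∫ z : Cd d, evalHom z P * gaussian z
  map_add' P R := by
    simp only [map_add, add_mul]
    exact integral_add (integrable_evalHom_mul_gaussian P) (integrable_evalHom_mul_gaussian R)
  map_smul' c P := by
    simp only [map_smul, smul_eq_mul, mul_assoc, RingHom.id_apply]
    exact integral_const_mul _ _

/-- Integration by parts in the direction `c e_i`. -/
theorem gaussianIntegral_by_parts [Nontrivial (Cd d)] (P : Poly d) (i : Fin d) (c : ℂ) :
    gaussianIntegral (c • (X (Sum.inr i) * P) + conj c • (X (Sum.inl i) * P)) =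
      gaussianIntegral (c • pderiv (Sum.inl i) P + conj c • pderiv (Sum.inr i) P) := by
  have h := integral_bilinear_hasLineDerivAt_right_eq_neg_left_of_integrable
    (μ := (volume : Measure (Cd d))) (B := ContinuousLinearMap.mul ℝ ℂ)
    (f := fun z => evalHom z P) (g := gaussian)
    (f' := fun z => evalHom z (c • pderiv (Sum.inl i) P + conj c • pderiv (Sum.inr i) P))
    (g' := fun z => -evalHom z (c • X (Sum.inr i) + conj c • X (Sum.inl i)) * gaussian z)
    (v := EuclideanSpace.single i c) (integrable_evalHom_mul_gaussian _)
    (by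
      refine (integrable_evalHom_mul_gaussian
        (-(P * (c • X (Sum.inr i) + conj c • X (Sum.inl i))))).congr (.of_forall fun z => ?_)
      simp
      ring)
    (integrable_evalHom_mul_gaussian _)
    (fun z _ => by simpa using hasLineDerivAt_evalHom P z i c)
    (fun z _ => by simpa using hasLineDerivAt_gaussian z i c)
  have h2 := neg_eq_iff_eq_neg.2 h
  rw [← integral_neg] at h2
  simp only [gaussianIntegral, LinearMap.coe_mk, AddHom.coe_mk]
  refine Eq.trans (integral_congr_ae (.of_forall fun z => ?_)) h2
  simp
  ring

/-- Under the Gaussian integral, multiplication by `conj z_i` is adjoint to `∂/∂z_i`, and likewise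
with the two kinds of variables exchanged. -/
theorem gaussianIntegral_X_mul [Nontrivial (Cd d)] (P : Poly d) (i : Fin d) :
    gaussianIntegral (X (Sum.inr i) * P) = gaussianIntegral (pderiv (Sum.inl i) P) ∧
      gaussianIntegral (X (Sum.inl i) * P) = gaussianIntegral (pderiv (Sum.inr i) P) := by
  -- The real directions `e_i` and `I e_i` separate the two formal derivatives.
  have h1 := gaussianIntegral_by_parts P i 1
  have h2 := gaussianIntegral_by_parts P i Complex.I
  simp only [map_add, map_smul, smul_eq_mul, map_one, one_mul, Complex.conj_I] at h1 h2
  have h3 := mul_left_cancel₀ Complex.I_ne_zero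
    (show Complex.I *
        (gaussianIntegral (X (Sum.inr i) * P) - gaussianIntegral (X (Sum.inl i) * P)) =
      Complex.I * (gaussianIntegral (pderiv (Sum.inl i) P) -
        gaussianIntegral (pderiv (Sum.inr i) P)) by linear_combination h2)
  constructor
  · linear_combination (h1 + h3) / 2
  · linear_combination (h1 - h3) / 2

theorem pderiv_comm {σ : Type*} (i j : σ) (P : MvPolynomial σ ℂ) :
    pderiv i (pderiv j P) = pderiv j (pderiv i P) := by
  have h : ⁅pderiv (R := ℂ) i, pderiv (R := ℂ) j⁆ = 0 := by
    refine derivation_ext fun k => ?_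
    classical
    simp only [Derivation.commutator_apply, pderiv_X, Pi.single_apply]
    split_ifs <;> simp
  have h2 := DFunLike.congr_fun h P
  rwa [Derivation.commutator_apply, Derivation.zero_apply, sub_eq_zero] at h2

/-- By Euler's identity and integration by parts, `q` times the Gaussian integral of `P` is the
Gaussian integral of `ΔP`, and so is `p` times it. -/
theorem gaussianIntegral_eq_zero [Nontrivial (Cd d)] {P : Poly d} (hP : P ∈ H d p q)
    (hpq : (p, q) ≠ (0, 0)) : gaussianIntegral P = 0 := by
  obtain ⟨hP, hL⟩ := mem_H.1 hP
  rw [laplacian_apply] at hL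
  have hor : p ≠ 0 ∨ q ≠ 0 := by
    by_contra! h
    exact hpq (Prod.ext h.1 h.2)
  rcases hor with h | h
  · have h1 := congrArg gaussianIntegral (sum_inl_mul_pderiv hP)
    rw [map_sum, Finset.sum_congr rfl fun i _ => (gaussianIntegral_X_mul _ i).2, ← map_sum,
      Finset.sum_congr rfl fun i _ => pderiv_comm (Sum.inr i) (Sum.inl i) P, hL,
      map_zero, map_smul] at h1
    exact (smul_eq_zero.1 h1.symm).resolve_left (Nat.cast_ne_zero.2 h)
  · have h1 := congrArg gaussianIntegral (sum_inr_mul_pderiv hP)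
    rw [map_sum, Finset.sum_congr rfl fun i _ => (gaussianIntegral_X_mul _ i).1, ← map_sum, hL,
      map_zero, map_smul] at h1
    exact (smul_eq_zero.1 h1.symm).resolve_left (Nat.cast_ne_zero.2 h)

/-- Integration of a homogeneous function against the Gaussian in polar coordinates. -/
theorem integral_mul_gaussian_of_homogeneous [Nontrivial (Cd d)] (k : ℕ) (f : Cd d → ℂ)
    (hf : ∀ (r : ℝ) (z : Cd d), 0 < r → f (r • z) = (r : ℂ) ^ k * f z) :
    ∫ z : Cd d, f z * gaussian z =
      (∫ u : Metric.sphere (0 : Cd d) 1, f u ∂(volume : Measure (Cd d)).toSphere) *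
        ∫ r : Set.Ioi (0 : ℝ), ((r : ℝ) : ℂ) ^ k * Complex.exp (-((r : ℝ) : ℂ) ^ 2)
          ∂Measure.volumeIoiPow (Module.finrank ℝ (Cd d) - 1) := by
  have h0 : ∫ z : Cd d, f z * gaussian z =
      ∫ z : ({0}ᶜ : Set (Cd d)), f z * gaussian (z : Cd d)
        ∂(volume : Measure (Cd d)).comap (↑) := by
    rw [integral_subtype_comap (measurableSet_singleton _).compl fun z : Cd d => f z * gaussian z,
      restrict_compl_singleton]
  rw [h0, ← integral_prod_mul,
    ← ((volume : Measure (Cd d)).measurePreserving_homeomorphUnitSphereProd).integral_comp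
      (Homeomorph.measurableEmbedding _)]
  refine integral_congr_ae (.of_forall fun z => ?_)
  have hz : 0 < ‖(z : Cd d)‖ := norm_pos_iff.2 z.2
  have hfz : f z = ((‖(z : Cd d)‖ : ℝ) : ℂ) ^ k * f (‖(z : Cd d)‖⁻¹ • (z : Cd d)) := by
    rw [← hf _ _ hz, smul_inv_smul₀ hz.ne']
  simp only [homeomorphUnitSphereProd_apply_fst_coe, homeomorphUnitSphereProd_apply_snd_coe]
  rw [hfz, gaussian_eq]
  push_cast
  ring

theorem integral_norm_pow_mul_gaussian_ne_zero [Nontrivial (Cd d)] (k : ℕ) :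
    ∫ z : Cd d, ((‖z‖ ^ k : ℝ) : ℂ) * gaussian z ≠ 0 := by
  have h1 : ∀ z : Cd d, ((‖z‖ ^ k : ℝ) : ℂ) * gaussian z =
      ((‖z‖ ^ k * Real.exp (-‖z‖ ^ 2) : ℝ) : ℂ) := fun z => by
    rw [gaussian_eq, ← Complex.ofReal_mul]
  simp only [h1]
  rw [integral_complex_ofReal, Complex.ofReal_ne_zero]
  refine ne_of_gt ((integral_pos_iff_support_of_nonneg (fun z => by positivity)
    (integrable_norm_pow_mul_exp k)).2 ?_)
  refine lt_of_lt_of_le (IsOpen.measure_pos volume (isOpen_compl_singleton (x := (0 : Cd d)))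
    ?_) (measure_mono fun z hz => ?_)
  · exact exists_ne (0 : Cd d)
  · have hz : 0 < ‖z‖ := norm_pos_iff.2 hz
    exact (show ‖z‖ ^ k * Real.exp (-‖z‖ ^ 2) ≠ 0 by positivity)

theorem evalHom_smul {P : Poly d} (hP : P ∈ bihomogeneous d p q) (r : ℝ) (z : Cd d) :
    evalHom (r • z) P = (r : ℂ) ^ (p + q) * evalHom z P := by
  rw [P.as_sum, map_sum, map_sum, Finset.mul_sum]
  refine Finset.sum_congr rfl fun m hm => ?_
  have h1 := hP.1 (mem_support_iff.1 hm)
  have h2 := hP.2 (mem_support_iff.1 hm)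
  rw [weight_holWeight] at h1
  rw [weight_antiWeight] at h2
  simp only [evalHom, aeval_monomial, Finsupp.prod_fintype, pow_zero, implies_true,
    Fintype.prod_sum_type, Sum.elim_inl, Sum.elim_inr, PiLp.smul_apply, Complex.real_smul, map_mul,
    Complex.conj_ofReal, mul_pow, Finset.prod_mul_distrib, Finset.prod_pow_eq_pow_sum, h1, h2]
  ring

theorem integral_sphere_eq_zero [Nontrivial (Cd d)] {P : Poly d} (hP : P ∈ H d p q)
    (hpq : (p, q) ≠ (0, 0)) :
    ∫ u : Metric.sphere (0 : Cd d) 1, evalAt P u ∂(volume : Measure (Cd d)).toSphere = 0 := by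
  have h1 := integral_mul_gaussian_of_homogeneous (p + q) (fun z : Cd d => evalHom z P)
    fun r z _ => evalHom_smul (mem_H.1 hP).1 r z
  have h2 := integral_mul_gaussian_of_homogeneous (p + q)
    (fun z : Cd d => ((‖z‖ ^ (p + q) : ℝ) : ℂ)) fun r z hr => by
      rw [norm_smul, Real.norm_of_nonneg hr.le, mul_pow]
      push_cast
      ring
  have h3 := right_ne_zero_of_mul (h2 ▸ integral_norm_pow_mul_gaussian_ne_zero (p + q))
  have h4 : ∫ z : Cd d, evalHom z P * gaussian z = 0 := gaussianIntegral_eq_zero hP hpq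
  simp only [← evalHom_apply]
  exact (mul_eq_zero.1 (h1.symm.trans h4)).resolve_right h3

theorem exists_eq_C_of_mem_H_zero {P : Poly d} (hP : P ∈ H d 0 0) : ∃ c : ℂ, P = C c := by
  refine ⟨coeff 0 P, ?_⟩
  ext m
  rw [coeff_C]
  split_ifs with h
  · rw [h]
  · by_contra hm
    have h1 := hP.1.1 hm
    have h2 := hP.1.2 hm
    rw [weight_holWeight, Finset.sum_eq_zero_iff] at h1
    rw [weight_antiWeight, Finset.sum_eq_zero_iff] at h2
    refine h (Finsupp.ext fun s => ?_)
    rcases s with i | i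
    · exact (h1 i (Finset.mem_univ i)).symm
    · exact (h2 i (Finset.mem_univ i)).symm

/-- The mean over the unit sphere, as a linear functional on polynomials. -/
def sphereMean (d : ℕ) : Poly d →ₗ[ℂ] ℂ where
  toFun P := ⨍ z : Metric.sphere (0 : Cd d) 1, evalAt P (z : Cd d)
    ∂(volume : Measure (Cd d)).toSphere
  map_add' P R := by
    have hint : ∀ P : Poly d, Integrable
        (fun z : Metric.sphere (0 : Cd d) 1 => evalHom (z : Cd d) P)
        (volume : Measure (Cd d)).toSphere := fun P =>
      ((continuous_evalHom P).comp continuous_subtype_val).integrable_of_hasCompactSupport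
        (HasCompactSupport.of_compactSpace _)
    simp only [← evalHom_apply, map_add, average_eq]
    rw [integral_add (hint P) (hint R), smul_add]
  map_smul' c P := by
    simp only [← evalHom_apply, map_smul, average_eq, RingHom.id_apply]
    rw [integral_smul, smul_comm]

theorem sphereMean_eq_zero [Nontrivial (Cd d)] {P : Poly d} (hP : P ∈ H d p q)
    (hpq : (p, q) ≠ (0, 0)) : sphereMean d P = 0 := by
  change ⨍ z : Metric.sphere (0 : Cd d) 1, evalAt P (z : Cd d)
    ∂(volume : Measure (Cd d)).toSphere = 0
  rw [average_eq, integral_sphere_eq_zero hP hpq, smul_zero]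

theorem sphereMean_C [Nontrivial (Cd d)] (c : ℂ) : sphereMean d (C c) = c := by
  have : NeZero (volume : Measure (Cd d)).toSphere := ⟨Measure.toSphere_ne_zero _⟩
  change ⨍ z : Metric.sphere (0 : Cd d) 1, evalAt (C c) (z : Cd d)
    ∂(volume : Measure (Cd d)).toSphere = c
  simp [evalAt]

theorem isDesign_iff {n : ℕ} {v : Fin n → Cd d} (hv : ∀ j, ‖v j‖ = 1) (τ : Finset (ℕ × ℕ)) :
    IsDesign τ v ↔ ∀ pq ∈ τ, ∀ P ∈ H d pq.1 pq.2,
      sphereMean d P = (1 / (n : ℂ)) * ∑ j, evalHom (v j) P := by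
  let L : Poly d →ₗ[ℂ] ℂ := (1 / (n : ℂ)) • ∑ j, (evalHom (v j)).toLinearMap
  have hL : ∀ P, L P = (1 / (n : ℂ)) * ∑ j, evalHom (v j) P := fun P => by simp [L]
  have h1 : IsDesign τ v ↔ polySpace d τ ≤ LinearMap.eqLocus (sphereMean d) L := by
    rw [IsDesign, and_iff_right hv]
    refine forall₂_congr fun P _ => ?_
    simp only [LinearMap.mem_eqLocus, hL, evalHom_apply]
    rfl
  rw [h1, polySpace, iSup₂_le_iff]
  refine forall₂_congr fun pq _ => forall₂_congr fun P _ => ?_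
  rw [LinearMap.mem_eqLocus, hL]

/-! ### The factorisation of the matrix through the harmonic polynomials -/

section factorisation

variable {n : ℕ} {v : Fin n → Cd d} (f : ℕ × ℕ →₀ ℂ)

/-- The external direct sum of the spaces `H(p,q)` over the support of the coefficients `f`. -/
abbrev HarmonicSum (d : ℕ) (f : ℕ × ℕ →₀ ℂ) : Type := (pq : f.support) → H d pq.1.1 pq.1.2

theorem finrank_harmonicSum :
    Module.finrank ℂ (HarmonicSum d f) = ∑ pq ∈ f.support, Module.finrank ℂ (H d pq.1 pq.2) := by
  rw [Module.finrank_pi_fintype,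
    Finset.sum_coe_sort f.support fun pq => Module.finrank ℂ (H d pq.1 pq.2)]

/-- The values of the sum of a family of harmonic polynomials at the points `v_j`. -/
def sampling (v : Fin n → Cd d) : HarmonicSum d f →ₗ[ℂ] Fin n → ℂ :=
  LinearMap.pi fun j => ∑ pq, (evalHom (v j)).toLinearMap ∘ₗ (H d _ _).subtype ∘ₗ LinearMap.proj pq

theorem sampling_apply (P : HarmonicSum d f) (j : Fin n) :
    sampling f v P j = ∑ pq, evalHom (v j) (P pq : Poly d) := by
  simp [sampling]

/-- The combinations of zonal harmonics with poles `v_k`, weighted by the coefficients `f`. -/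
def synthesis (hd : 1 ≤ d) (hv : ∀ j, ‖v j‖ = 1) : (Fin n → ℂ) →ₗ[ℂ] HarmonicSum d f :=
  LinearMap.pi fun pq => f pq.1 • ∑ k, (LinearMap.proj k).smulRight
    (⟨zonal d pq.1.1 pq.1.2 (v k), zonal_mem_H hd (hv k) _ _⟩ : H d pq.1.1 pq.1.2)

theorem synthesis_apply (hd : 1 ≤ d) (hv : ∀ j, ‖v j‖ = 1)
    (c : Fin n → ℂ) (pq : f.support) :
    (synthesis f hd hv c pq : Poly d) =
      f pq.1 • ∑ k, c k • zonal d pq.1.1 pq.1.2 (v k) := by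
  simp [synthesis]

theorem mulVecLin_eq_sampling_comp_synthesis (hd : 1 ≤ d) (hv : ∀ j, ‖v j‖ = 1) :
    (Matrix.of fun j k : Fin n => expansion d f (ip (v j) (v k))).mulVecLin =
      sampling f v ∘ₗ synthesis f hd hv := by
  refine LinearMap.ext fun c => funext fun j => ?_
  simp only [Matrix.mulVecLin_apply, Matrix.mulVec, dotProduct, Matrix.of_apply,
    LinearMap.comp_apply, sampling_apply, synthesis_apply, map_smul, map_sum,
    evalHom_zonal (hv j), expansion, Finsupp.sum, smul_eq_mul, Finset.sum_mul, Finset.mul_sum]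
  rw [Finset.sum_comm, ← Finset.sum_coe_sort f.support]
  exact Finset.sum_congr rfl fun pq _ => Finset.sum_congr rfl fun k _ => by ring

theorem rank_le_finrank_harmonicSum (hd : 1 ≤ d) (hv : ∀ j, ‖v j‖ = 1) :
    (Matrix.of fun j k : Fin n => expansion d f (ip (v j) (v k))).rank ≤
      Module.finrank ℂ (HarmonicSum d f) := by
  rw [Matrix.rank, mulVecLin_eq_sampling_comp_synthesis f hd hv]
  exact (Submodule.finrank_mono (LinearMap.range_comp_le_range _ _)).trans
    (LinearMap.finrank_range_le _)

variable {f}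

/-- If the matrix is the identity and the dimensions agree, the two factors are inverse to each
other in either order. -/
theorem synthesis_sampling (hd : 1 ≤ d) (hv : ∀ j, ‖v j‖ = 1)
    (hM : (Matrix.of fun j k : Fin n => expansion d f (ip (v j) (v k))) = 1)
    (hn : n = Module.finrank ℂ (HarmonicSum d f)) (P : HarmonicSum d f) :
    synthesis f hd hv (sampling f v P) = P := by
  have h1 : ∀ c, sampling f v (synthesis f hd hv c) = c := fun c => by
    have := congrArg (fun L => L c) (mulVecLin_eq_sampling_comp_synthesis f hd hv)
    simpa [hM] using this.symm
  have h2 : Function.Injective (sampling f v) := by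
    rw [LinearMap.injective_iff_surjective_of_finrank_eq_finrank (by simp [← hn])]
    exact fun c => ⟨_, h1 c⟩
  exact h2 (h1 _)

theorem sampling_single [DecidableEq f.support] (pq : f.support) (P : H d pq.1.1 pq.1.2) :
    sampling f v (Pi.single pq P) = fun j => evalHom (v j) (P : Poly d) := by
  funext j
  rw [sampling_apply, Finset.sum_eq_single pq]
  · simp
  · intro rs _ hrs
    simp [Pi.single_eq_of_ne hrs]
  · simp

/-- In the case of equality every coefficient is `1 / n`: the diagonal block at `(p, q)` of
`synthesis ∘ sampling` is the identity of `H(p,q)`, of trace `dim H(p,q)`, and it is also a sum of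
`n` operators of rank one, each of trace `f_{pq} Q_{pq}(1) = f_{pq} dim H(p,q)`. -/
theorem coeff_eq_one_div_of_eq (hd : 1 ≤ d) (hv : ∀ j, ‖v j‖ = 1)
    (hM : (Matrix.of fun j k : Fin n => expansion d f (ip (v j) (v k))) = 1)
    (hn : n = Module.finrank ℂ (HarmonicSum d f)) {pq : ℕ × ℕ} (hpq : pq ∈ f.support)
    (hH : H d pq.1 pq.2 ≠ ⊥) : f pq = 1 / (n : ℂ) := by
  classical
  have h1 : (LinearMap.id : H d pq.1 pq.2 →ₗ[ℂ] H d pq.1 pq.2) =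
      ∑ k, f pq • ((evalHom (v k)).toLinearMap ∘ₗ (H d pq.1 pq.2).subtype).smulRight
        (⟨zonal d pq.1 pq.2 (v k), zonal_mem_H hd (hv k) _ _⟩ : H d pq.1 pq.2) := by
    ext1 P
    refine Subtype.ext ?_
    have h := congrArg (fun R : HarmonicSum d f => (R ⟨pq, hpq⟩ : Poly d))
      (synthesis_sampling hd hv hM hn (Pi.single ⟨pq, hpq⟩ P))
    simp only [synthesis_apply, sampling_single, Pi.single_eq_same] at h
    refine h.symm.trans ?_
    simp [Finset.smul_sum]
  have h2 := congrArg (LinearMap.trace ℂ (H d pq.1 pq.2)) h1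
  simp only [LinearMap.trace_id, map_sum, map_smul, LinearMap.trace_smulRight,
    LinearMap.comp_apply, Submodule.subtype_apply, AlgHom.toLinearMap_apply, evalHom_zonal (hv _),
    ip_self (hv _), Q_one hd, Finset.sum_const, Finset.card_univ, Fintype.card_fin, nsmul_eq_mul,
    smul_eq_mul] at h2
  have h3 : (Module.finrank ℂ (H d pq.1 pq.2) : ℂ) ≠ 0 :=
    Nat.cast_ne_zero.2 (Nat.one_le_iff_ne_zero.1 (Submodule.one_le_finrank_iff.2 hH))
  have h4 : (n : ℂ) * f pq = 1 := mul_right_cancel₀ h3 (by linear_combination -h2)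
  rw [eq_div_iff (left_ne_zero_of_mul_eq_one h4), mul_comm, h4]

/-- The off-diagonal blocks of `synthesis ∘ sampling` vanish; for the block that maps to `H(0,0)`
this says that the sample means are zero. -/
theorem sum_evalHom_eq_zero_of_eq (hd : 1 ≤ d) (hv : ∀ j, ‖v j‖ = 1)
    (hM : (Matrix.of fun j k : Fin n => expansion d f (ip (v j) (v k))) = 1)
    (hn : n = Module.finrank ℂ (HarmonicSum d f)) {pq : ℕ × ℕ} (hpq : pq ∈ f.support)
    (h00 : (0, 0) ∈ f.support) (hne : pq ≠ (0, 0)) {P : Poly d} (hP : P ∈ H d pq.1 pq.2) :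
    ∑ j, evalHom (v j) P = 0 := by
  classical
  have h := congrArg (fun R : HarmonicSum d f => (R ⟨(0, 0), h00⟩ : Poly d))
    (synthesis_sampling hd hv hM hn (Pi.single ⟨pq, hpq⟩ ⟨P, hP⟩))
  have hne' : (⟨(0, 0), h00⟩ : f.support) ≠ ⟨pq, hpq⟩ := fun h => hne (congrArg Subtype.val h).symm
  simp only [synthesis_apply, sampling_single, Pi.single_eq_of_ne hne', zonal, and_self, if_true,
    ← Finset.sum_smul, ZeroMemClass.coe_zero, smul_eq_zero, one_ne_zero, or_false] at h
  exact h.resolve_left (Finsupp.mem_support_iff.1 h00)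

/-- If `(0, 0)` is not in `τ`, the values at the points of a design sum to zero for all elements
of `P_τ`; but in the case of equality every vector, also the constant one, consists of such
values. -/
theorem isDesign_iff_of_eq (hd : 1 ≤ d) (hv : ∀ j, ‖v j‖ = 1)
    (hM : (Matrix.of fun j k : Fin n => expansion d f (ip (v j) (v k))) = 1)
    (hn : n = Module.finrank ℂ (HarmonicSum d f)) (hn0 : n ≠ 0) :
    IsDesign f.support v ↔ (0, 0) ∈ f.support := by
  have : Nontrivial (Cd d) := ⟨⟨v ⟨0, Nat.pos_of_ne_zero hn0⟩, 0, fun h => by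
    simpa [h] using hv ⟨0, Nat.pos_of_ne_zero hn0⟩⟩⟩
  have hnC : (n : ℂ) ≠ 0 := Nat.cast_ne_zero.2 hn0
  rw [isDesign_iff hv]
  constructor
  · intro h
    by_contra h00
    have h1 : ∀ pq ∈ f.support, ∀ P ∈ H d pq.1 pq.2, ∑ j, evalHom (v j) P = 0 := by
      intro pq hpq P hP
      have h2 := h pq hpq P hP
      rw [sphereMean_eq_zero hP fun h0 => h00 (h0 ▸ hpq)] at h2
      simpa [hn0] using h2.symm
    have h3 := congrArg (fun L => L 1) (mulVecLin_eq_sampling_comp_synthesis f hd hv)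
    simp only [hM, Matrix.mulVecLin_one, LinearMap.id_apply, LinearMap.comp_apply] at h3
    have h4 := congrArg (fun c => ∑ j, c j) h3
    simp only [sampling_apply, Pi.one_apply, Finset.sum_const, Finset.card_univ, Fintype.card_fin,
      nsmul_eq_mul, mul_one] at h4
    rw [Finset.sum_comm, Finset.sum_eq_zero fun pq _ => h1 pq.1 pq.2 _ (Subtype.prop _)] at h4
    exact hnC h4
  · intro h00 pq hpq P hP
    by_cases h0 : pq = (0, 0)
    · subst h0
      obtain ⟨c, rfl⟩ := exists_eq_C_of_mem_H_zero hP
      have hc : ∀ z : Cd d, evalHom z (C c) = c := fun z => by simp [evalHom]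
      simp [sphereMean_C, hc, hnC]
    · rw [sphereMean_eq_zero hP h0, sum_evalHom_eq_zero_of_eq hd hv hM hn hpq h00 h0 hP, mul_zero]

end factorisation

/-! ### Vanishing of `H(p,q)` and of `Q_{pq}` -/

/-- For `d ≥ 2` the polynomial `z_1 ^ p * conj z_2 ^ q` is harmonic. -/
theorem H_ne_bot (hd : 2 ≤ d) (p q : ℕ) : H d p q ≠ ⊥ := by
  let a : Fin d := ⟨0, by omega⟩
  let b : Fin d := ⟨1, by omega⟩
  have hab : a ≠ b := by simp [a, b]
  rw [Submodule.ne_bot_iff]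
  refine ⟨X (Sum.inl a) ^ p * X (Sum.inr b) ^ q, mem_H.2 ⟨?_, ?_⟩, ?_⟩
  · simpa using bihomogeneous_mul (bihomogeneous_pow (X_inl_mem a) p)
      (bihomogeneous_pow (X_inr_mem b) q)
  · rw [laplacian_apply]
    refine Finset.sum_eq_zero fun i _ => ?_
    by_cases hi : i = b
    · subst hi
      simp [Derivation.leibniz, Derivation.leibniz_pow, pderiv_X, hab]
    · have h : ¬ b = i := fun h => hi h.symm
      simp [Derivation.leibniz, Derivation.leibniz_pow, pderiv_X, h]
  · exact mul_ne_zero (pow_ne_zero _ (X_ne_zero _)) (pow_ne_zero _ (X_ne_zero _))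

/-- Where `H(p,q)` vanishes, which happens only for `d = 1`, so does `Q_{pq}` on the inner products
of unit vectors. -/
theorem Q_ip_eq_zero (hd : 1 ≤ d) (hH : H d p q = ⊥) {z w : Cd d} (hz : ‖z‖ = 1) (hw : ‖w‖ = 1) :
    Q d p q (ip z w) = 0 := by
  have h := zonal_mem_H hd hw p q
  rw [hH, Submodule.mem_bot] at h
  rw [← evalHom_zonal hz, h, map_zero]

theorem eq_sum_finrank_of_expansion_one {n : ℕ} (hd : 1 ≤ d) {f : ℕ × ℕ →₀ ℂ}
    (h : (1 : ℂ) = (1 / (n : ℂ)) * ∑ pq ∈ f.support, Q d pq.1 pq.2 1) :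
    n = ∑ pq ∈ f.support, Module.finrank ℂ (H d pq.1 pq.2) := by
  have hn : (n : ℂ) ≠ 0 := by
    intro h0
    simp [h0] at h
  simp only [Q_one hd] at h
  field_simp at h
  exact_mod_cast h

end ComplexDesign

end

theorem mainTheorem6 (d n : ℕ) (hd : 1 ≤ d)
    (v : Fin n → ComplexDesign.Cd d) (hv : ∀ j, ‖v j‖ = 1)
    (f : ℕ × ℕ →₀ ℂ) (hF : ComplexDesign.expansion d f 1 = 1)
    (A : Set ℂ) (hA : A = {z : ℂ | ‖z‖ ≤ 1 ∧ ComplexDesign.expansion d f z = 0})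
    (τ : Finset (ℕ × ℕ)) (hτ : τ = f.support) :
    (Matrix.of fun j k : Fin n =>
        ComplexDesign.expansion d f (ComplexDesign.ip (v j) (v k))).rank ≤
      min n (∑ pq ∈ τ, Module.finrank ℂ (ComplexDesign.H d pq.1 pq.2)) ∧
    (ComplexDesign.IsCode A v →
      n ≤ ∑ pq ∈ τ, Module.finrank ℂ (ComplexDesign.H d pq.1 pq.2) ∧
      (n = ∑ pq ∈ τ, Module.finrank ℂ (ComplexDesign.H d pq.1 pq.2) ↔
        ∀ z w : ComplexDesign.Cd d, ‖z‖ = 1 → ‖w‖ = 1 →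
          ComplexDesign.expansion d f (ComplexDesign.ip z w) =
            (1 / (n : ℂ)) * ∑ pq ∈ τ, ComplexDesign.Q d pq.1 pq.2 (ComplexDesign.ip z w)) ∧
      ((2 ≤ d ∨ ∀ pq ∈ τ, ComplexDesign.H d pq.1 pq.2 ≠ ⊥) →
        (n = ∑ pq ∈ τ, Module.finrank ℂ (ComplexDesign.H d pq.1 pq.2) ↔
          ∀ z : ℂ, ComplexDesign.expansion d f z =
            (1 / (n : ℂ)) * ∑ pq ∈ τ, ComplexDesign.Q d pq.1 pq.2 z)) ∧
      (n = ∑ pq ∈ τ, Module.finrank ℂ (ComplexDesign.H d pq.1 pq.2) →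
        (∀ j k, j ≠ k →
          ComplexDesign.expansion d f (ComplexDesign.ip (v j) (v k)) = 0) ∧
        (ComplexDesign.IsDesign τ v ↔ (0, 0) ∈ τ))) := by
  subst hA hτ
  have hrank := ComplexDesign.rank_le_finrank_harmonicSum f hd hv
  rw [ComplexDesign.finrank_harmonicSum] at hrank
  refine ⟨le_min ((Matrix.rank_le_card_height _).trans_eq (Fintype.card_fin n)) hrank, ?_⟩
  intro hcode
  have hM : (Matrix.of fun j k : Fin n =>
      ComplexDesign.expansion d f (ComplexDesign.ip (v j) (v k))) = 1 := by
    ext j k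
    by_cases hjk : j = k
    · subst hjk
      simp [ComplexDesign.ip_self (hv j), hF]
    · simpa [Matrix.one_apply_ne hjk] using (hcode j k hjk).2
  rw [hM, Matrix.rank_one, Fintype.card_fin] at hrank
  have hcoeff : n = ∑ pq ∈ f.support, Module.finrank ℂ (ComplexDesign.H d pq.1 pq.2) →
      ∀ pq ∈ f.support, ComplexDesign.H d pq.1 pq.2 ≠ ⊥ → f pq = 1 / (n : ℂ) := by
    intro hn pq hpq hH
    rw [← ComplexDesign.finrank_harmonicSum] at hn
    exact ComplexDesign.coeff_eq_one_div_of_eq hd hv hM hn hpq hH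
  refine ⟨hrank, ⟨fun hn z w hz hw => ?_, fun h => ?_⟩, fun hdH => ⟨fun hn z => ?_, fun h => ?_⟩,
    fun hn => ⟨fun j k hjk => (hcode j k hjk).2, ?_⟩⟩
  · rw [ComplexDesign.expansion, Finsupp.sum, Finset.mul_sum]
    refine Finset.sum_congr rfl fun pq hpq => ?_
    by_cases hH : ComplexDesign.H d pq.1 pq.2 = ⊥
    · rw [ComplexDesign.Q_ip_eq_zero hd hH hz hw, mul_zero, mul_zero]
    · rw [hcoeff hn pq hpq hH]
  · have hu : ‖(EuclideanSpace.single ⟨0, hd⟩ 1 : ComplexDesign.Cd d)‖ = 1 := by simp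
    have h1 := h _ _ hu hu
    rw [ComplexDesign.ip_self hu, hF] at h1
    exact ComplexDesign.eq_sum_finrank_of_expansion_one hd h1
  · rw [ComplexDesign.expansion, Finsupp.sum, Finset.mul_sum]
    refine Finset.sum_congr rfl fun pq hpq => ?_
    rw [hcoeff hn pq hpq
      (hdH.elim (fun h2 => ComplexDesign.H_ne_bot h2 _ _) fun h => h pq hpq)]
  · exact ComplexDesign.eq_sum_finrank_of_expansion_one hd (hF.symm.trans (h 1))
  · refine ComplexDesign.isDesign_iff_of_eq hd hv hM
      (hn.trans (ComplexDesign.finrank_harmonicSum f).symm) ?_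
    rintro rfl
    -- Without points all spaces would vanish, so `F(1) = ∑ f_{pq} dim H(p,q)` would be zero.
    have h0 : ComplexDesign.expansion d f 1 = 0 := by
      refine Finset.sum_eq_zero fun pq hpq => ?_
      dsimp only
      rw [ComplexDesign.Q_one hd, Finset.sum_eq_zero_iff.1 hn.symm pq hpq, Nat.cast_zero, mul_zero]
    exact one_ne_zero (hF.symm.trans h0)
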